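/- Let $\mathbb K$ be $\mathbb R$ or $\mathbb C$; all Banach spaces are over $\mathbb K$ and operators are bounded and linear. For operators $S:W\to Z$ and $T:X\to Y$ between Banach spaces, $S$ *factors through* $T$ if there are operators $U:W\to X$ and $V:Y\to Z$ with $VTU=S$; an operator is *universal* for a class $\mathscr C$ of operators between Banach spaces if it belongs to $\mathscr C$ and factors through every member of $\mathscr C$. Let $\{0,1\}^\omega$ carry the product topology and let $C(\{0,1\}^\omega)$ be the Banach space of $\mathbb K$-valued continuous functions on it with the supremum norm. Let $(t_m)_{m\ge 1}$ enumerate the finite $0$-$1$ sequences by length and, within each length, lexicographically, so that $\{0,1\}^n=\{t_m\mid 2^n\le m<2^{n+1}\}$ for every $n\ge 0$. For a finite $0$-$1$ sequence $t$ let $\Delta_t\subseteq\{0,1\}^\omega$ be the set of infinite sequences with initial segment $t$ and $\chi_{\Delta_t}$ its indicator function. The Haar system is $h_0=\chi_{\{0,1\}^\omega}$ and $h_m=\chi_{\Delta_{t_m{}^\smallfrown 0}}-\chi_{\Delta_{t_m{}^\smallfrown 1}}$ for $m\ge 1$. Let $(e_m)_{m\ge1}$ be the standard unit vector basis of $\ell_1$.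 There is a unique operator $J:\ell_1\to C(\{0,1\}^\omega)$ with $Je_m=h_{m-1}$ for all $m\ge1$. If $X$ and $Y$ are Banach spaces with $Y$ separable, and $T:X\to Y$ is an operator whose adjoint $T^*:Y^*\to X^*$ has non-separable range $T^*(Y^*)$ in the norm topology, then $J$ factors through $T$. Moreover, $J$ is universal for the class of operators with separable codomain and adjoint of non-separable range; that is, $J$ also belongs to this class. -/

import Mathlib

open TopologicalSpace

universe u v w w₂ w₃

/-! ### The Haar system on the Cantor space

`{0,1}^ω` is `ℕ → Bool` with the product topology (`false` is `0`, `true` is `1`), and the set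
`𝒟` of finite sequences in `{0,1}` is `List Bool`. -/

/-- The enumeration `(t_m)_{m ≥ 1}` of the finite `0`-`1` sequences, by length and then
lexicographically: `t_m` is the binary expansion of `m`, most significant digit first, without its
leading `1`. (The value at `m = 0` is not used.) -/
def dyadicNode (m : ℕ) : List Bool := (Nat.bits m).reverse.tail

theorem dyadicNode_one : dyadicNode 1 = [] := by
  simp [dyadicNode]

theorem dyadicNode_bit (b : Bool) {m : ℕ} (hm : m ≠ 0) :
    dyadicNode (Nat.bit b m) = dyadicNode m ++ [b] := by
  have h : (Nat.bits m).reverse ≠ [] := by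
    intro h
    have h1 : Nat.bits m = [] := by simpa using h
    have h2 := Nat.size_eq_bits_len m
    rw [h1] at h2
    exact hm (Nat.size_eq_zero.1 h2.symm)
  unfold dyadicNode
  rw [Nat.bits_append_bit m b (fun h0 => absurd h0 hm), List.reverse_cons,
    List.tail_append_of_ne_nil h]

/-- The first property that determines the enumeration:
`{0,1}^n = {t_m | 2^n ≤ m < 2^(n+1)}`. -/
theorem image_dyadicNode (n : ℕ) :
    dyadicNode '' {m | 2 ^ n ≤ m ∧ m < 2 ^ (n + 1)} = {t | t.length = n} := by
  induction n with
  | zero =>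
    ext t
    simp only [Set.mem_image, Set.mem_ofPred_eq, List.length_eq_zero_iff]
    constructor
    · rintro ⟨m, ⟨h1, h2⟩, rfl⟩
      obtain rfl : m = 1 := by simp at h1 h2; omega
      exact dyadicNode_one
    · rintro rfl
      exact ⟨1, by norm_num, dyadicNode_one⟩
  | succ n ih =>
    ext t
    constructor
    · rintro ⟨m, ⟨h1, h2⟩, rfl⟩
      obtain ⟨b, k, rfl⟩ : ∃ b k, m = Nat.bit b k := ⟨_, _, (Nat.bit_bodd_div2 m).symm⟩
      have hk : 2 ^ n ≤ k ∧ k < 2 ^ (n + 1) := by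
        cases b <;> simp only [Nat.bit_false_apply, Nat.bit_true_apply, pow_succ] at h1 h2 ⊢ <;>
          omega
      have hk0 : k ≠ 0 := (lt_of_lt_of_le (by positivity) hk.1).ne'
      have h3 : dyadicNode k ∈ {t : List Bool | t.length = n} := ih ▸ ⟨k, hk, rfl⟩
      simp only [Set.mem_ofPred_eq] at h3 ⊢
      rw [dyadicNode_bit b hk0, List.length_append, h3, List.length_singleton]
    · intro ht
      have hne : t ≠ [] := by rintro rfl; simp at ht
      have h3 : t.dropLast ∈ {t : List Bool | t.length = n} := by
        simp only [Set.mem_ofPred_eq] at ht ⊢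
        simp [ht]
      rw [← ih] at h3
      obtain ⟨k, hk, hkt⟩ := h3
      have hk0 : k ≠ 0 := (lt_of_lt_of_le (by positivity) hk.1).ne'
      refine ⟨Nat.bit (t.getLast hne) k, ?_, ?_⟩
      · obtain ⟨h1, h2⟩ := hk
        cases t.getLast hne <;>
          simp only [Set.mem_ofPred_eq, Nat.bit_false_apply, Nat.bit_true_apply, pow_succ]
            at h1 h2 ⊢ <;> omega
      · rw [dyadicNode_bit _ hk0, hkt, List.dropLast_append_getLast]

/-- The second property that determines the enumeration: within one level, it increases
lexicographically. -/
theorem dyadicNode_lex (n : ℕ) : ∀ l m : ℕ, 2 ^ n ≤ l → l < m → m < 2 ^ (n + 1) →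
    ∃ k < n, (∀ j < k, (dyadicNode l)[j]? = (dyadicNode m)[j]?) ∧
      (dyadicNode l)[k]? = some false ∧ (dyadicNode m)[k]? = some true := by
  induction n with
  | zero => intro l m h1 h2 h3; simp at h1 h3; omega
  | succ n ih =>
    intro l m h1 h2 h3
    obtain ⟨a, p, rfl⟩ : ∃ b k, l = Nat.bit b k := ⟨_, _, (Nat.bit_bodd_div2 l).symm⟩
    obtain ⟨b, q, rfl⟩ : ∃ b k, m = Nat.bit b k := ⟨_, _, (Nat.bit_bodd_div2 m).symm⟩
    have hp : 2 ^ n ≤ p ∧ p ≤ q ∧ q < 2 ^ (n + 1) ∧ (p = q → a = false ∧ b = true) := by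
      cases a <;> cases b <;>
        simp only [Nat.bit_false_apply, Nat.bit_true_apply, pow_succ] at h1 h2 h3 ⊢ <;>
        refine ⟨by omega, by omega, by omega, fun h => ?_⟩ <;> first | omega | simp
    obtain ⟨hp1, hpq, hq, hab⟩ := hp
    have hp0 : p ≠ 0 := (lt_of_lt_of_le (by positivity) hp1).ne'
    have hq0 : q ≠ 0 := by omega
    have hlen : ∀ r, 2 ^ n ≤ r → r < 2 ^ (n + 1) → (dyadicNode r).length = n := by
      intro r hr1 hr2
      have : dyadicNode r ∈ {t : List Bool | t.length = n} :=
        image_dyadicNode n ▸ ⟨r, ⟨hr1, hr2⟩, rfl⟩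
      exact this
    have hlp := hlen p hp1 (by omega)
    have hlq := hlen q (by omega) hq
    rw [dyadicNode_bit a hp0, dyadicNode_bit b hq0]
    rcases hpq.eq_or_lt with rfl | hlt
    · obtain ⟨rfl, rfl⟩ := hab rfl
      refine ⟨n, by omega, fun j hj => ?_, ?_, ?_⟩
      · rw [List.getElem?_append_left (by omega), List.getElem?_append_left (by omega)]
      · rw [List.getElem?_append_right (by omega), hlp]; simp
      · rw [List.getElem?_append_right (by omega), hlp]; simp
    · obtain ⟨k, hk, h4, h5, h6⟩ := ih p q hp1 hlt hq
      refine ⟨k, by omega, fun j hj => ?_, ?_, ?_⟩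
      · rw [List.getElem?_append_left (by omega), List.getElem?_append_left (by omega)]
        exact h4 j hj
      · rw [List.getElem?_append_left (by omega)]; exact h5
      · rw [List.getElem?_append_left (by omega)]; exact h6

/-- `Δ_t`: the infinite `0`-`1` sequences that have `t` as an initial segment. -/
def cylinderSet (t : List Bool) : Set (ℕ → Bool) :=
  {s | ∀ k (hk : k < t.length), s k = t[k]}

theorem isClopen_cylinderSet (t : List Bool) : IsClopen (cylinderSet t) := by
  have h : cylinderSet t = ⋂ k : Fin t.length, (fun s : ℕ → Bool => s k) ⁻¹' {t[k]} := by
    ext s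
    simp [cylinderSet, Fin.forall_iff]
  rw [h]
  exact isClopen_iInter_of_finite fun k => (isClopen_discrete _).preimage (continuous_apply _)

/-- The indicator function of `Δ_t`, as an element of `C({0,1}^ω)`. -/
noncomputable def cylinderChar (𝕜 : Type*) [RCLike 𝕜] (t : List Bool) : C(ℕ → Bool, 𝕜) where
  toFun := (cylinderSet t).indicator 1
  continuous_toFun := continuous_one.indicator (by simp [(isClopen_cylinderSet t).frontier_eq])

/-- The Haar system `(h_m)_{m ≥ 0}` of `C({0,1}^ω)`. -/
noncomputable def haarSystem (𝕜 : Type*) [RCLike 𝕜] : ℕ → C(ℕ → Bool, 𝕜)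
  | 0 => 1
  | m + 1 => cylinderChar 𝕜 (dyadicNode (m + 1) ++ [false]) -
      cylinderChar 𝕜 (dyadicNode (m + 1) ++ [true])

/-! ### Factorization and universality -/

section Operators

variable {𝕜 : Type*} [RCLike 𝕜]
  {W : Type*} [NormedAddCommGroup W] [NormedSpace 𝕜 W]
  {X : Type*} [NormedAddCommGroup X] [NormedSpace 𝕜 X]
  {Y : Type*} [NormedAddCommGroup Y] [NormedSpace 𝕜 Y]
  {Z : Type*} [NormedAddCommGroup Z] [NormedSpace 𝕜 Z]

/-- `S` factors through `T`: there are bounded operators `U`, `V` with `V T U = S`. -/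
def OperatorFactorsThrough (S : W →L[𝕜] Z) (T : X →L[𝕜] Y) : Prop :=
  ∃ (U : W →L[𝕜] X) (V : Y →L[𝕜] Z), V ∘L T ∘L U = S

/-- The Banach space adjoint `T* : Y* → X*`, `T* φ = φ ∘ T`, between the norm duals. -/
noncomputable def banachAdjoint (T : X →L[𝕜] Y) : StrongDual 𝕜 Y →L[𝕜] StrongDual 𝕜 X :=
  T.precomp 𝕜

/-- `T` belongs to the class of operators that have a separable codomain and an adjoint whose
range is not (norm) separable. -/
def SepCodomainNonsepAdjoint (T : X →L[𝕜] Y) : Prop :=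
  SeparableSpace Y ∧ ¬ IsSeparable (Set.range (banachAdjoint T))

end Operators

/-- `S` is universal for the class of operators between Banach spaces over `𝕜` that have separable
codomain and adjoint with non-separable range: it belongs to the class and factors through every
member of the class. -/
def IsUniversalSepCodomainNonsepAdjoint {𝕜 : Type w} [RCLike 𝕜]
    {W : Type w₂} [NormedAddCommGroup W] [NormedSpace 𝕜 W] [CompleteSpace W]
    {Z : Type w₃} [NormedAddCommGroup Z] [NormedSpace 𝕜 Z] [CompleteSpace Z]
    (S : W →L[𝕜] Z) : Prop :=
  SepCodomainNonsepAdjoint S ∧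
    ∀ (X : Type u) [NormedAddCommGroup X] [NormedSpace 𝕜 X] [CompleteSpace X]
      (Y : Type v) [NormedAddCommGroup Y] [NormedSpace 𝕜 Y] [CompleteSpace Y]
      (T : X →L[𝕜] Y), SepCodomainNonsepAdjoint T → OperatorFactorsThrough S T

/-- `J : ℓ₁ → C({0,1}^ω)` sends the `m`-th unit vector to the `m`-th Haar function. Coordinates of
`ℓ₁` are counted from `0` here; counted from `1`, this reads `J e_m = h_{m-1}` for `m ≥ 1`. -/
def MapsUnitVectorsToHaar {𝕜 : Type*} [RCLike 𝕜]
    (J : lp (fun _ : ℕ => 𝕜) 1 →L[𝕜] C(ℕ → Bool, 𝕜)) : Prop :=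
  ∀ m : ℕ, J (lp.single 1 m (1 : 𝕜)) = haarSystem 𝕜 m

/-! Let `T : X → Y` have an adjoint with non-separable range. Then the unit ball of the dual of `Y`
contains a nonempty set `A` such that, for every weak* open set `U` that meets `A`, the image of
`U ∩ A` under `T*` is not within a fixed distance of any separable set. Hence each functional in `A`
is arbitrarily weak* close to two functionals in `A` that take prescribed values at a bounded vector
annihilated by any given finite set of functionals on `X`. Iterating, we obtain a dyadic tree of
functionals and a bounded sequence `x` such that the weak* limits along the paths of the tree define
an operator `V : Y → C({0,1}^ω)` with `V (T (x m))` within `q ^ m` of the `m`-th Haar function, for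
`q > 0` as small as we like. The vectors `T (x m)` have biorthogonal functionals whose norms grow at
most geometrically, with a ratio that does not depend on `q`, so for small `q` adding a nuclear
operator to `V` makes the approximation exact. -/

open Filter Metric Topology

theorem exists_seq_of_forall_exists_extension {α : Type*} {Q : ∀ m : ℕ, (Fin m → α) → α → Prop}
    (h : ∀ m p, ∃ a, Q m p a) : ∃ f : ℕ → α, ∀ m, Q m (fun i => f i) (f m) := by
  choose next hnext using h
  refine ⟨fun m => Nat.strongRec (fun m p => next m fun i => p i i.2) m, fun m => ?_⟩
  beta_reduce
  rw [Nat.strongRec_eq _ m]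
  exact hnext m _

/-! ### Separability up to a positive distance -/

section Separability

theorem exists_nonempty_forall_nhds_of_isHereditarilyLindelof {K : Type*} [TopologicalSpace K]
    {S : Set K} (hS : IsHereditarilyLindelof S) {p : Set K → Prop}
    (hmono : ∀ ⦃s t⦄, s ⊆ t → p t → p s)
    (hsUnion : ∀ 𝒮 : Set (Set K), 𝒮.Countable → (∀ s ∈ 𝒮, p s) → p (⋃₀ 𝒮)) (hp : ¬ p S) :
    ∃ A ⊆ S, A.Nonempty ∧ ∀ a ∈ A, ∀ U ∈ 𝓝 a, ¬ p (U ∩ A) := by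
  let D := {a ∈ S | ∃ t ∈ 𝓝[S] a, p t}
  have hDS : D ⊆ S := Set.sep_subset _ _
  have hD : p D := (hS.isLindelof_subset hDS).induction_on hmono hsUnion fun a ha =>
    ha.2.imp fun t ht => ⟨nhdsWithin_mono a hDS ht.1, ht.2⟩
  have hDU : ∀ t, p t → p (t ∪ D) := fun t ht =>
    Set.sUnion_pair t D ▸ hsUnion _ (Set.toFinite _).countable (by simp [ht, hD])
  refine ⟨S \ D, Set.sdiff_subset, ?_, fun a ha U hU hUp => ha.2 ⟨ha.1, S ∩ U, ?_, ?_⟩⟩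
  · exact Set.sdiff_nonempty.2 fun hSD => hp (hmono hSD hD)
  · exact inter_mem_nhdsWithin S hU
  · refine hmono (fun b hb => ?_) (hDU _ hUp)
    by_cases hbD : b ∈ D
    exacts [.inr hbD, .inl ⟨hb.2, hb.1, hbD⟩]

theorem isHereditarilyLindelof_of_subtype {K : Type*} [TopologicalSpace K] {S : Set K}
    [HereditarilyLindelofSpace S] : IsHereditarilyLindelof S := fun t ht => by
  have h := Subtype.isLindelof_iff.1
    (HereditarilyLindelofSpace.isLindelof (Subtype.val ⁻¹' t : Set S))
  rwa [Subtype.image_preimage_coe, Set.inter_eq_right.2 ht] at h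

variable {E : Type*} [PseudoMetricSpace E] {δ : ℝ} {S S' : Set E}

/-- `S` is contained in the closed `δ`-neighbourhood of a separable set. For fixed `δ` these sets
form a `σ`-ideal. -/
def IsApproxSeparable (δ : ℝ) (S : Set E) : Prop :=
  ∃ F : Set E, IsSeparable F ∧ S ⊆ cthickening δ F

theorem IsApproxSeparable.mono (h : IsApproxSeparable δ S) (hS : S' ⊆ S) :
    IsApproxSeparable δ S' :=
  h.imp fun _ hF => ⟨hF.1, hS.trans hF.2⟩

theorem IsApproxSeparable.sUnion {𝒮 : Set (Set E)} (h𝒮 : 𝒮.Countable)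
    (h : ∀ s ∈ 𝒮, IsApproxSeparable δ s) : IsApproxSeparable δ (⋃₀ 𝒮) := by
  choose! F hF hSF using h
  have := h𝒮.to_subtype
  refine ⟨⋃ s : 𝒮, F s, .iUnion fun s => hF s s.2, Set.sUnion_subset fun s hs => ?_⟩
  exact (hSF s hs).trans
    (cthickening_subset_of_subset δ (Set.subset_iUnion_of_subset ⟨s, hs⟩ subset_rfl))

theorem isSeparable_of_forall_isApproxSeparable (h : ∀ δ > 0, IsApproxSeparable δ S) :
    IsSeparable S := by
  choose F hF hSF using fun n : ℕ => h (1 / ((n : ℝ) + 1)) (by positivity)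
  refine (IsSeparable.iUnion hF).closure.mono fun a ha => Metric.mem_closure_iff.2 fun ε hε => ?_
  obtain ⟨n, hn⟩ := exists_nat_one_div_lt hε
  obtain ⟨z, hz, haz⟩ :=
    mem_thickening_iff.1 (cthickening_subset_thickening' hε hn (F n) (hSF n ha))
  exact ⟨z, Set.mem_iUnion_of_mem n hz, haz⟩

theorem countable_of_isSeparable_range {ι : Type*} {f : ι → E} (hf : IsSeparable (Set.range f))
    {r : ℝ} (hr : 0 < r) (h : Pairwise fun i j => r ≤ dist (f i) (f j)) : Countable ι := by
  have := hf.separableSpace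
  refine Pairwise.countable_of_isOpen_disjoint
    (s := fun i => (Subtype.val ⁻¹' ball (f i) (r / 2) : Set (Set.range f))) ?_ ?_ ?_
  · exact fun i j hij => (ball_disjoint_ball (by linarith [h hij])).preimage _
  · exact fun i => isOpen_ball.preimage continuous_subtype_val
  · exact fun i => ⟨⟨f i, i, rfl⟩, mem_ball_self (half_pos hr)⟩

end Separability

/-! ### Duality -/

section Duality

variable {𝕜 : Type*} [RCLike 𝕜]
  {X : Type*} [NormedAddCommGroup X] [NormedSpace 𝕜 X]
  {Y : Type*} [NormedAddCommGroup Y] [NormedSpace 𝕜 Y]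

theorem mem_span_of_forall_apply_eq_zero {G : Set (StrongDual 𝕜 X)} (hG : G.Finite)
    {f : StrongDual 𝕜 X} (h : ∀ x, (∀ g ∈ G, g x = 0) → f x = 0) : f ∈ Submodule.span 𝕜 G := by
  have := hG.to_subtype
  have hf : (f : X →ₗ[𝕜] 𝕜) ∈ Submodule.span 𝕜 (Set.range fun g : G => (g : X →ₗ[𝕜] 𝕜)) := by
    refine mem_span_of_iInf_ker_le_ker fun x hx => h x fun g hg => ?_
    exact (Submodule.mem_iInf _).1 hx ⟨g, hg⟩
  have hrange : (Set.range fun g : G => (g : X →ₗ[𝕜] 𝕜)) = ContinuousLinearMap.coeLM 𝕜 '' G :=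
    Set.image_eq_range _ _ |>.symm
  rw [hrange, Submodule.span_image] at hf
  exact ContinuousLinearMap.coe_injective.mem_set_image.1 hf

theorem exists_apply_eq_one_of_notMem_cthickening_span {G : Set (StrongDual 𝕜 X)} (hG : G.Finite)
    {f : StrongDual 𝕜 X} {δ : ℝ} (hδ : 0 < δ)
    (hf : f ∉ cthickening δ (Submodule.span 𝕜 G : Set (StrongDual 𝕜 X))) :
    ∃ x : X, ‖x‖ ≤ δ⁻¹ ∧ (∀ g ∈ G, g x = 0) ∧ f x = 1 := by
  let p : Subspace 𝕜 X := ⨅ g ∈ G, LinearMap.ker (g : X →ₗ[𝕜] 𝕜)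
  have mem_p : ∀ x, x ∈ p ↔ ∀ g ∈ G, g x = 0 := fun x => by simp [p, Submodule.mem_iInf]
  obtain ⟨F, hF, hF_norm⟩ := exists_extension_norm_eq p (f ∘L p.subtypeL)
  have hspan : f - F ∈ Submodule.span 𝕜 G := mem_span_of_forall_apply_eq_zero hG fun x hx => by
    simpa [sub_eq_zero] using (hF ⟨x, (mem_p x).2 hx⟩).symm
  have hδf : δ < ‖f ∘L p.subtypeL‖ := by
    by_contra! hle
    exact hf (mem_cthickening_of_dist_le _ _ _ _ hspan (by simpa [dist_eq_norm, hF_norm] using hle))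
  obtain ⟨z, hz⟩ : ∃ z : p, δ * ‖z‖ < ‖f z‖ := by
    by_contra! hle
    exact hδf.not_ge (ContinuousLinearMap.opNorm_le_bound _ hδ.le hle)
  have hfz : 0 < ‖f z‖ := (mul_nonneg hδ.le (norm_nonneg z)).trans_lt hz
  refine ⟨(f z)⁻¹ • (z : X), ?_, (mem_p _).1 (p.smul_mem _ z.2), ?_⟩
  · rw [norm_smul, norm_inv, inv_mul_le_iff₀ hfz, ← div_eq_mul_inv, le_div_iff₀' hδ]
    exact hz.le
  · simp [norm_pos_iff.1 hfz]

theorem exists_apply_eq_apply_eq_of_notMem_cthickening_span {G : Set (StrongDual 𝕜 X)}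
    (hG : G.Finite) {f f' : StrongDual 𝕜 X} {δ : ℝ} (hδ : 0 < δ)
    (hf : f ∉ cthickening δ (Submodule.span 𝕜 G : Set (StrongDual 𝕜 X)))
    (hf' : f' ∉ cthickening δ (Submodule.span 𝕜 (insert f G) : Set (StrongDual 𝕜 X)))
    {α β : 𝕜} (hα : ‖α‖ ≤ 1) (hβ : ‖β‖ ≤ 1) :
    ∃ x : X, ‖x‖ ≤ δ⁻¹ + (1 + ‖f'‖ * δ⁻¹) * δ⁻¹ ∧ (∀ g ∈ G, g x = 0) ∧ f x = α ∧ f' x = β := by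
  obtain ⟨z, hz, hGz, hfz⟩ := exists_apply_eq_one_of_notMem_cthickening_span hG hδ hf
  obtain ⟨z', hz', hGz', hfz'⟩ :=
    exists_apply_eq_one_of_notMem_cthickening_span (hG.insert f) hδ hf'
  rw [Set.forall_mem_insert] at hGz'
  refine ⟨α • z + (β - f' (α • z)) • z', ?_, fun g hg => ?_, ?_, ?_⟩
  · have hαz : ‖α • z‖ ≤ δ⁻¹ := by
      rw [norm_smul]
      exact (mul_le_of_le_one_left (norm_nonneg z) hα).trans hz
    refine norm_add_le_of_le hαz ?_
    rw [norm_smul]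
    gcongr
    exact norm_sub_le_of_le hβ (f'.le_opNorm_of_le hαz)
  · simp [hGz g hg, hGz'.2 g hg]
  · simp [hfz, hGz'.1]
  · simp [hfz']

theorem exists_not_isApproxSeparable_image_closedBall (T : X →L[𝕜] Y)
    (hT : ¬ IsSeparable (Set.range T)) : ∃ δ > 0, ¬ IsApproxSeparable δ (T '' closedBall 0 1) := by
  by_contra! h
  refine hT ((isSeparable_of_forall_isApproxSeparable h).span (R := 𝕜) |>.mono ?_)
  rintro _ ⟨x, rfl⟩
  obtain rfl | hx := eq_or_ne x 0
  · simp
  have hmem : T ((‖x‖ : 𝕜)⁻¹ • x) ∈ T '' closedBall 0 1 :=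
    Set.mem_image_of_mem T (by simp [norm_smul_inv_norm hx])
  have := Submodule.smul_mem _ (‖x‖ : 𝕜) (Submodule.subset_span (R := 𝕜) hmem)
  simpa [smul_smul, hx] using this

theorem isHereditarilyLindelof_of_isCompact_weakDual [SeparableSpace X] {K : Set (WeakDual 𝕜 X)}
    (hK : IsCompact K) : IsHereditarilyLindelof K := by
  have := isCompact_iff_compactSpace.1 hK
  have := WeakDual.metrizable_of_isCompact 𝕜 X K hK
  let _ := metrizableSpaceMetric K
  exact isHereditarilyLindelof_of_subtype

theorem exists_nonempty_forall_nhds_not_isApproxSeparable [SeparableSpace Y] (T : X →L[𝕜] Y)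
    (hT : ¬ IsSeparable (Set.range (banachAdjoint T))) :
    ∃ δ > 0, ∃ A : Set (WeakDual 𝕜 Y), A.Nonempty ∧ (∀ a ∈ A, ‖WeakDual.toStrongDual a‖ ≤ 1) ∧
      ∀ a ∈ A, ∀ U ∈ 𝓝 a,
        ¬ IsApproxSeparable δ
          ((fun b => banachAdjoint T (WeakDual.toStrongDual b)) '' (U ∩ A)) := by
  obtain ⟨δ, hδ, hball⟩ := exists_not_isApproxSeparable_image_closedBall _ hT
  obtain ⟨A, hA_sub, hA_ne, hA⟩ := exists_nonempty_forall_nhds_of_isHereditarilyLindelof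
    (isHereditarilyLindelof_of_isCompact_weakDual
      (WeakDual.isCompact_closedBall (𝕜 := 𝕜) (0 : StrongDual 𝕜 Y) 1))
    (p := fun s => IsApproxSeparable δ ((fun b => banachAdjoint T (WeakDual.toStrongDual b)) '' s))
    (fun s t hst ht => ht.mono (Set.image_mono hst))
    (fun 𝒮 h𝒮 h => by
      rw [Set.sUnion_eq_biUnion, Set.image_iUnion₂, ← Set.sUnion_image]
      exact .sUnion (h𝒮.image _) (Set.forall_mem_image.2 h))
    (by rwa [← Set.image_image, Set.image_preimage_eq _ WeakDual.toStrongDual.surjective])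
  exact ⟨δ, hδ, A, hA_ne, fun a ha => mem_closedBall_zero_iff.1 (hA_sub ha), hA⟩

theorem exists_fork_of_forall_nhds_not_isApproxSeparable (T : X →L[𝕜] Y) {δ : ℝ} (hδ : 0 < δ)
    {A : Set (WeakDual 𝕜 Y)} (hA_le : ∀ a ∈ A, ‖WeakDual.toStrongDual a‖ ≤ 1)
    (hA : ∀ a ∈ A, ∀ U ∈ 𝓝 a,
      ¬ IsApproxSeparable δ ((fun b => banachAdjoint T (WeakDual.toStrongDual b)) '' (U ∩ A)))
    {a : WeakDual 𝕜 Y} (ha : a ∈ A) {U : Set (WeakDual 𝕜 Y)} (hU : U ∈ 𝓝 a)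
    {G : Set (StrongDual 𝕜 X)} (hG : G.Finite) {v : Bool → 𝕜} (hv : ∀ e, ‖v e‖ ≤ 1) :
    ∃ (b : Bool → WeakDual 𝕜 Y) (x : X), (∀ e, b e ∈ U ∩ A) ∧
      ‖x‖ ≤ δ⁻¹ + (1 + ‖T‖ * δ⁻¹) * δ⁻¹ ∧ (∀ g ∈ G, g x = 0) ∧ ∀ e, b e (T x) = v e := by
  have exists_far : ∀ F : Set (StrongDual 𝕜 X), F.Finite → ∃ b ∈ U ∩ A,
      banachAdjoint T (WeakDual.toStrongDual b) ∉
        cthickening δ (Submodule.span 𝕜 F : Set (StrongDual 𝕜 X)) := by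
    intro F hF
    by_contra! h
    exact hA a ha U hU ⟨_, hF.countable.isSeparable.span, Set.image_subset_iff.2 h⟩
  obtain ⟨b, hb, hbG⟩ := exists_far G hG
  obtain ⟨b', hb', hbG'⟩ := exists_far _ (hG.insert (banachAdjoint T (WeakDual.toStrongDual b)))
  obtain ⟨x, hx, hGx, hbx, hbx'⟩ := exists_apply_eq_apply_eq_of_notMem_cthickening_span hG hδ hbG
    hbG' (hv false) (hv true)
  refine ⟨fun e => cond e b' b, x, Bool.forall_bool.2 ⟨hb, hb'⟩, hx.trans ?_, hGx,
    Bool.forall_bool.2 ⟨hbx, hbx'⟩⟩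
  gcongr
  exact (ContinuousLinearMap.opNorm_comp_le _ T).trans
    (mul_le_of_le_one_left (norm_nonneg T) (hA_le b' hb'.2))

theorem setOf_forall_norm_apply_sub_lt_mem_nhds (a : WeakDual 𝕜 Y) {E : Set Y} (hE : E.Finite)
    {η : ℝ} (hη : 0 < η) : {b : WeakDual 𝕜 Y | ∀ z ∈ E, ‖b z - a z‖ < η} ∈ 𝓝 a := by
  refine (Filter.eventually_all_finite hE).2 fun z _ => ?_
  have hcont : Continuous fun b : WeakDual 𝕜 Y => ‖b z - a z‖ :=
    ((WeakDual.eval_continuous z).sub continuous_const).norm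
  exact hcont.continuousAt.eventually_lt_const (by simpa using hη)

theorem exists_forking_set [SeparableSpace Y] (T : X →L[𝕜] Y)
    (hT : ¬ IsSeparable (Set.range (banachAdjoint T))) :
    ∃ (A : Set (StrongDual 𝕜 Y)) (C : ℝ), A.Nonempty ∧ (∀ a ∈ A, ‖a‖ ≤ 1) ∧
      ∀ a ∈ A, ∀ E : Set Y, E.Finite → ∀ η > 0, ∀ G : Set (StrongDual 𝕜 Y), G.Finite →
        ∀ v : Bool → 𝕜, (∀ e, ‖v e‖ ≤ 1) → ∃ (b : Bool → StrongDual 𝕜 Y) (x : X),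
          (∀ e, b e ∈ A) ∧ (∀ e, ∀ z ∈ E, ‖b e z - a z‖ < η) ∧ ‖x‖ ≤ C ∧
          (∀ g ∈ G, g (T x) = 0) ∧ ∀ e, b e (T x) = v e := by
  obtain ⟨δ, hδ, A, hA_ne, hA_le, hA⟩ := exists_nonempty_forall_nhds_not_isApproxSeparable T hT
  refine ⟨WeakDual.toStrongDual '' A, δ⁻¹ + (1 + ‖T‖ * δ⁻¹) * δ⁻¹, hA_ne.image _,
    Set.forall_mem_image.2 hA_le, Set.forall_mem_image.2 fun a ha E hE η hη G hG v hv => ?_⟩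
  obtain ⟨b, x, hb, hx, hGx, hbx⟩ := exists_fork_of_forall_nhds_not_isApproxSeparable T hδ hA_le hA
    ha (setOf_forall_norm_apply_sub_lt_mem_nhds a hE hη) (hG.image (banachAdjoint T)) hv
  exact ⟨fun e => WeakDual.toStrongDual (b e), x, fun e => Set.mem_image_of_mem _ (hb e).2,
    fun e => (hb e).1, hx, Set.forall_mem_image.1 hGx, hbx⟩

end Duality

/-! ### Paths in the dyadic tree and the Haar system -/

/-- The number, in the enumeration `dyadicNode`, of the initial segment of length `n` of `s`. -/
def pathIndex (s : ℕ → Bool) : ℕ → ℕ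
  | 0 => 1
  | n + 1 => Nat.bit (s n) (pathIndex s n)

theorem lt_pathIndex (s : ℕ → Bool) (n : ℕ) : n < pathIndex s n := by
  induction n with
  | zero => exact one_pos
  | succ n ih =>
    rw [pathIndex, Nat.bit_val]
    omega

theorem pathIndex_ne_zero (s : ℕ → Bool) (n : ℕ) : pathIndex s n ≠ 0 :=
  Nat.ne_zero_of_lt (lt_pathIndex s n)

theorem pathIndex_strictMono (s : ℕ → Bool) : StrictMono (pathIndex s) :=
  strictMono_nat_of_lt_succ fun n => by
    have := lt_pathIndex s n
    rw [pathIndex, Nat.bit_val]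
    omega

theorem continuous_pathIndex (n : ℕ) : Continuous fun s => pathIndex s n := by
  induction n with
  | zero => exact continuous_const
  | succ n ih =>
    exact (continuous_of_discreteTopology (f := fun q : Bool × ℕ => Nat.bit q.1 q.2)).comp
      ((continuous_apply n).prodMk ih)

theorem pathIndex_congr {s s' : ℕ → Bool} {n : ℕ} (h : ∀ k < n, s k = s' k) :
    pathIndex s n = pathIndex s' n := by
  induction n with
  | zero => rfl
  | succ n ih =>
    rw [pathIndex, pathIndex, ih fun k hk => h k (hk.trans n.lt_succ_self), h n n.lt_succ_self]

theorem length_dyadicNode_pathIndex (s : ℕ → Bool) (n : ℕ) :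
    (dyadicNode (pathIndex s n)).length = n := by
  induction n with
  | zero => rw [pathIndex, dyadicNode_one, List.length_nil]
  | succ n ih =>
    rw [pathIndex, dyadicNode_bit _ (pathIndex_ne_zero s n), List.length_append, ih,
      List.length_singleton]

theorem mem_cylinderSet_append {t : List Bool} {b : Bool} {s : ℕ → Bool} :
    s ∈ cylinderSet (t ++ [b]) ↔ s ∈ cylinderSet t ∧ s t.length = b := by
  constructor
  · intro h
    refine ⟨fun k hk => ?_, by simpa using h t.length (by simp)⟩
    simpa [List.getElem_append_left hk] using h k (hk.trans (by simp))
  · rintro ⟨h, h'⟩ k hk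
    rcases Nat.lt_succ_iff_lt_or_eq.1 (show k < t.length + 1 by simpa using hk) with hk' | rfl
    · rw [List.getElem_append_left hk', h k hk']
    · simpa using h'

theorem mem_cylinderSet_dyadicNode_pathIndex (s : ℕ → Bool) (n : ℕ) :
    s ∈ cylinderSet (dyadicNode (pathIndex s n)) := by
  induction n with
  | zero => simp [pathIndex, dyadicNode_one, cylinderSet]
  | succ n ih =>
    rw [pathIndex, dyadicNode_bit _ (pathIndex_ne_zero s n), mem_cylinderSet_append]
    exact ⟨ih, by rw [length_dyadicNode_pathIndex]⟩

theorem pathIndex_length_of_mem_cylinderSet_dyadicNode {m : ℕ} (hm : m ≠ 0) {s : ℕ → Bool}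
    (hs : s ∈ cylinderSet (dyadicNode m)) : pathIndex s (dyadicNode m).length = m := by
  induction m using Nat.binaryRec' with
  | zero => exact absurd rfl hm
  | bit b m hb ih =>
    obtain rfl | hm' := eq_or_ne m 0
    · obtain rfl := hb rfl
      simp [dyadicNode_one, pathIndex]
    · rw [dyadicNode_bit b hm', mem_cylinderSet_append] at hs
      rw [dyadicNode_bit b hm', List.length_append, List.length_singleton, pathIndex,
        ih hm' hs.1, hs.2]

theorem mem_cylinderSet_dyadicNode {m : ℕ} (hm : m ≠ 0) {s : ℕ → Bool} :
    s ∈ cylinderSet (dyadicNode m) ↔ pathIndex s (dyadicNode m).length = m :=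
  ⟨pathIndex_length_of_mem_cylinderSet_dyadicNode hm,
    fun h => h ▸ mem_cylinderSet_dyadicNode_pathIndex s _⟩

section HaarSystem

variable (𝕜 : Type*) [RCLike 𝕜]

theorem haarSystem_apply {m : ℕ} (hm : m ≠ 0) (s : ℕ → Bool) :
    haarSystem 𝕜 m s = if pathIndex s (dyadicNode m).length = m then
      (if s (dyadicNode m).length then -1 else 1) else 0 := by
  classical
  obtain ⟨m, rfl⟩ := Nat.exists_eq_succ_of_ne_zero hm
  simp only [← mem_cylinderSet_dyadicNode hm, haarSystem, cylinderChar, ContinuousMap.sub_apply,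
    ContinuousMap.coe_mk, Set.indicator_apply, mem_cylinderSet_append, Pi.one_apply]
  by_cases h : s ∈ cylinderSet (dyadicNode (m + 1)) <;>
    cases h' : s (dyadicNode (m + 1)).length <;> simp_all

theorem haarSystem_pathIndex_apply (s : ℕ → Bool) (n : ℕ) :
    haarSystem 𝕜 (pathIndex s n) s = if s n then -1 else 1 := by
  simp [haarSystem_apply 𝕜 (pathIndex_ne_zero s n), length_dyadicNode_pathIndex]

theorem haarSystem_apply_of_forall_pathIndex_ne {m : ℕ} (hm : m ≠ 0) {s : ℕ → Bool}
    (h : ∀ n, pathIndex s n ≠ m) : haarSystem 𝕜 m s = 0 := by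
  rw [haarSystem_apply 𝕜 hm, if_neg (h _)]

theorem norm_haarSystem_le (m : ℕ) : ‖haarSystem 𝕜 m‖ ≤ 1 := by
  refine (ContinuousMap.norm_le _ zero_le_one).2 fun s => ?_
  obtain rfl | hm := eq_or_ne m 0
  · simp [haarSystem]
  · rw [haarSystem_apply 𝕜 hm]
    split_ifs <;> simp

theorem exists_one_le_norm_haarSystem_apply_sub {s s' : ℕ → Bool} (h : s ≠ s') :
    ∃ m, 1 ≤ ‖haarSystem 𝕜 m s - haarSystem 𝕜 m s'‖ := by
  refine ⟨pathIndex s (PiNat.firstDiff s s'), ?_⟩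
  have hdiff := PiNat.apply_firstDiff_ne h
  rw [haarSystem_pathIndex_apply, pathIndex_congr fun k hk => PiNat.apply_eq_of_lt_firstDiff hk,
    haarSystem_pathIndex_apply]
  revert hdiff
  cases s (PiNat.firstDiff s s') <;> cases s' (PiNat.firstDiff s s') <;>
    norm_num [RCLike.norm_ofNat]

end HaarSystem

/-! ### Haar trees -/

section HaarTree

variable {𝕜 : Type*} [RCLike 𝕜]
  {X : Type*} [NormedAddCommGroup X] [NormedSpace 𝕜 X]
  {Y : Type*} [NormedAddCommGroup Y] [NormedSpace 𝕜 Y]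

/-- A tree of functionals `c j` of norm at most `1`, indexed by the nodes of the dyadic tree (node
`m` has the children `Nat.bit false m` and `Nat.bit true m`, the root is `1`, and the extra node `0`
above it serves the constant function `haarSystem 𝕜 0`), together with vectors `x m` whose images
`T (x m)` are approximately seen along each path `s` as the numbers `haarSystem 𝕜 m s`: exactly so
just below node `m`, and up to errors that are powers of `q` further down. The functionals also
stabilize along paths at the points `y k`. -/
structure IsHaarTree (T : X →L[𝕜] Y) (y : ℕ → Y) (q : ℝ) (c : ℕ → StrongDual 𝕜 Y) (x : ℕ → X) :
    Prop where
  norm_le_one (j : ℕ) : ‖c j‖ ≤ 1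
  apply_bit (m : ℕ) (e : Bool) :
    c (Nat.bit e m) (T (x m)) = if m ≠ 0 ∧ e = true then -1 else 1
  apply_of_lt {m j : ℕ} (h : j < 2 * m) : c j (T (x m)) = 0
  norm_sub_lt {k m : ℕ} (h : k < m) (e : Bool) {z : Y} (hz : z ∈ ({y k, T (x k)} : Set Y)) :
    ‖c (Nat.bit e m) z - c m z‖ < q ^ m

theorem exists_isHaarTree [SeparableSpace Y] (T : X →L[𝕜] Y)
    (hT : ¬ IsSeparable (Set.range (banachAdjoint T))) :
    ∃ C : ℝ, ∀ (y : ℕ → Y) {q : ℝ}, 0 < q → ∃ c x, IsHaarTree T y q c x ∧ ∀ m, ‖x m‖ ≤ C := by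
  obtain ⟨A, C, ⟨a₀, ha₀⟩, hA_le, hA⟩ := exists_forking_set T hT
  refine ⟨C, fun y q hq => ?_⟩
  let Fork := {d : (Bool → StrongDual 𝕜 Y) × X // (∀ e, d.1 e ∈ A) ∧ ‖d.2‖ ≤ C}
  obtain ⟨f, hf⟩ := exists_seq_of_forall_exists_extension (α := Fork) (Q := fun m p d =>
    (∀ e, d.1.1 e (T d.1.2) = if m ≠ 0 ∧ e = true then -1 else 1) ∧
    (∀ i e, (p i).1.1 e (T d.1.2) = 0) ∧
    ∀ (i : Fin m) e, ∀ z ∈ ({y i, T (p i).1.2} : Set Y),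
      ‖d.1.1 e z - (p ⟨m / 2, Nat.div_lt_self i.pos one_lt_two⟩).1.1 m.bodd z‖ < q ^ m) (by
    intro m p
    obtain ⟨a, ha, ha_parent⟩ : ∃ a ∈ A, ∀ hm : 0 < m,
        (p ⟨m / 2, Nat.div_lt_self hm one_lt_two⟩).1.1 m.bodd = a := by
      obtain rfl | hm := m.eq_zero_or_pos
      · exact ⟨a₀, ha₀, fun h => absurd h (lt_irrefl 0)⟩
      · exact ⟨_, (p ⟨m / 2, Nat.div_lt_self hm one_lt_two⟩).2.1 m.bodd, fun _ => rfl⟩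
    obtain ⟨b, x, hbA, hba, hx, hpx, hbx⟩ := hA a ha (⋃ i : Fin m, {y i, T (p i).1.2})
      (Set.finite_iUnion fun i => Set.toFinite _) (q ^ m) (pow_pos hq m)
      (Set.range fun i : Fin m × Bool => (p i.1).1.1 i.2) (Set.finite_range _)
      (fun e => if m ≠ 0 ∧ e = true then -1 else 1) fun e => by split_ifs <;> simp
    refine ⟨⟨(b, x), hbA, hx⟩, hbx, fun i e => hpx _ ⟨(i, e), rfl⟩, fun i e z hz => ?_⟩
    rw [ha_parent i.pos]
    exact hba e z (Set.mem_iUnion_of_mem i hz))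
  refine ⟨fun j => (f (j / 2)).1.1 j.bodd, fun m => (f m).1.2, ⟨fun j => ?_, fun m e => ?_,
    fun {m j} h => ?_, fun {k m} h e {z} hz => ?_⟩, fun m => (f m).2.2⟩
  · exact hA_le _ ((f _).2.1 _)
  · simpa [Nat.bit_div_two] using (hf m).1 e
  · exact (hf m).2.1 ⟨j / 2, by omega⟩ j.bodd
  · simpa [Nat.bit_div_two] using (hf m).2.2 ⟨k, h⟩ e z hz

variable {T : X →L[𝕜] Y} {y : ℕ → Y} {q : ℝ} {c : ℕ → StrongDual 𝕜 Y} {x : ℕ → X}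

theorem IsHaarTree.pos (h : IsHaarTree T y q c x) : 0 < q := by
  simpa using (norm_nonneg _).trans_lt (h.norm_sub_lt one_pos false (.inl rfl))

theorem IsHaarTree.exists_lt_pathIndex_apply_eq (h : IsHaarTree T y q c x) (m : ℕ)
    (s : ℕ → Bool) :
    ∃ n, m < pathIndex s n ∧ c (pathIndex s n) (T (x m)) = haarSystem 𝕜 m s := by
  obtain rfl | hm := eq_or_ne m 0
  · exact ⟨0, one_pos, by simpa [haarSystem, pathIndex] using h.apply_bit 0 true⟩
  by_cases hs : ∃ n, pathIndex s n = m
  · obtain ⟨n, rfl⟩ := hs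
    refine ⟨n + 1, pathIndex_strictMono s n.lt_succ_self, ?_⟩
    simp [haarSystem_pathIndex_apply, pathIndex, h.apply_bit, pathIndex_ne_zero]
  · push Not at hs
    have hex : ∃ n, m < pathIndex s n := ⟨m, lt_pathIndex s m⟩
    obtain ⟨p, hp⟩ : ∃ p, Nat.find hex = p + 1 :=
      Nat.exists_eq_succ_of_ne_zero fun h0 => hm (Nat.lt_one_iff.1 ((Nat.find_eq_zero hex).1 h0))
    have hlt : pathIndex s p < m :=
      (not_lt.1 (Nat.find_min hex (hp ▸ p.lt_succ_self))).lt_of_ne (hs p)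
    refine ⟨p + 1, hp ▸ Nat.find_spec hex, ?_⟩
    rw [haarSystem_apply_of_forall_pathIndex_ne 𝕜 hm hs, h.apply_of_lt]
    exact Nat.bit_false_apply m ▸ Nat.bit_lt_bit (s p) false hlt

theorem IsHaarTree.norm_pathIndex_succ_sub_le (h : IsHaarTree T y q c x) (hq : q ≤ 1)
    {s : ℕ → Bool} {k j n : ℕ} (hk : k < pathIndex s n) (hj : j ≤ pathIndex s n) {z : Y}
    (hz : z ∈ ({y k, T (x k)} : Set Y)) :
    ‖c (pathIndex s (n + 1)) z - c (pathIndex s n) z‖ ≤ q ^ j :=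
  (h.norm_sub_lt hk (s n) hz).le.trans (pow_le_pow_of_le_one h.pos.le hq hj)

/-- The operator that sends `z` to the function `s ↦ c (pathIndex s n) z`. -/
noncomputable def pathOperator (c : ℕ → StrongDual 𝕜 Y) {M : ℝ} (hM : ∀ j, ‖c j‖ ≤ M) (n : ℕ) :
    Y →L[𝕜] C(ℕ → Bool, 𝕜) :=
  LinearMap.mkContinuous
    { toFun z := ⟨fun s => c (pathIndex s n) z,
        (continuous_of_discreteTopology (f := fun j => c j z)).comp (continuous_pathIndex n)⟩
      map_add' z z' := by ext s; simp
      map_smul' r z := by ext s; simp } M fun z =>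
    (ContinuousMap.norm_le _ (mul_nonneg ((norm_nonneg _).trans (hM 0)) (norm_nonneg _))).2
      fun _ => (c _).le_of_opNorm_le (hM _) z

theorem norm_pathOperator_le (c : ℕ → StrongDual 𝕜 Y) {M : ℝ} (hM : ∀ j, ‖c j‖ ≤ M) (n : ℕ) :
    ‖pathOperator c hM n‖ ≤ M :=
  LinearMap.mkContinuous_norm_le _ ((norm_nonneg _).trans (hM 0)) _

theorem cauchySeq_apply_of_dense {α β : Type*} [PseudoMetricSpace α] [PseudoMetricSpace β]
    {f : ℕ → α → β} {K : NNReal} (hf : ∀ n, LipschitzWith K (f n)) {D : Set α} (hD : Dense D)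
    (h : ∀ a ∈ D, CauchySeq fun n => f n a) (a : α) : CauchySeq fun n => f n a := by
  refine Metric.cauchySeq_iff'.2 fun ε hε => ?_
  obtain ⟨r, hr, hKr⟩ := exists_pos_mul_lt (div_pos hε three_pos) (K : ℝ)
  obtain ⟨b, hb, hab⟩ := hD.exists_dist_lt a hr
  obtain ⟨N, hN⟩ := Metric.cauchySeq_iff'.1 (h b hb) (ε / 3) (div_pos hε three_pos)
  have hfab : ∀ n, dist (f n a) (f n b) < ε / 3 := fun n =>
    ((hf n).dist_le_mul_of_le hab.le).trans_lt hKr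
  refine ⟨N, fun n hn => ?_⟩
  calc dist (f n a) (f N a)
      ≤ dist (f n a) (f n b) + dist (f n b) (f N b) + dist (f N b) (f N a) := dist_triangle4 ..
    _ < ε / 3 + ε / 3 + ε / 3 := by
      gcongr
      exacts [hfab n, hN n hn, dist_comm (f N a) _ ▸ hfab N]
    _ = ε := add_thirds ε

theorem exists_tendsto_apply_of_dense {Z : Type*} [NormedAddCommGroup Z] [NormedSpace 𝕜 Z]
    [CompleteSpace Z] {V : ℕ → Y →L[𝕜] Z} {M : ℝ} (hV : ∀ n, ‖V n‖ ≤ M) {D : Set Y}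
    (hD : Dense D) (h : ∀ z ∈ D, CauchySeq fun n => V n z) :
    ∃ W : Y →L[𝕜] Z, ∀ z, Tendsto (fun n => V n z) atTop (𝓝 (W z)) := by
  have hLip : ∀ n, LipschitzWith M.toNNReal (V n) := fun n =>
    (V n).lipschitz.weaken (NNReal.le_toNNReal_of_coe_le (hV n))
  choose W hW using fun z => cauchySeq_tendsto_of_complete (cauchySeq_apply_of_dense hLip hD h z)
  have hbdd : Bornology.IsBounded (Set.range V) :=
    isBounded_iff_forall_norm_le.2 ⟨M, Set.forall_mem_range.2 hV⟩
  exact ⟨.ofTendstoOfBoundedRange W V (tendsto_pi_nhds.2 hW) hbdd, hW⟩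

theorem IsHaarTree.exists_tendsto_pathOperator (h : IsHaarTree T y q c x) (hq : q < 1)
    (hy : DenseRange y) : ∃ V : Y →L[𝕜] C(ℕ → Bool, 𝕜),
      ∀ z, Tendsto (fun n => pathOperator c h.norm_le_one n z) atTop (𝓝 (V z)) := by
  refine exists_tendsto_apply_of_dense (norm_pathOperator_le c h.norm_le_one) hy
    (Set.forall_mem_range.2 fun k => (cauchySeq_shift k).1 ?_)
  refine cauchySeq_of_le_geometric q 1 hq fun n => ?_
  rw [dist_comm, dist_eq_norm, one_mul, add_right_comm,
    ContinuousMap.norm_le _ (pow_nonneg h.pos.le n)]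
  intro s
  have hlt := lt_pathIndex s (n + k)
  exact h.norm_pathIndex_succ_sub_le hq.le (by omega) (by omega) (.inl rfl)

theorem IsHaarTree.norm_sub_haarSystem_le_of_tendsto (h : IsHaarTree T y q c x) (hq : q ≤ 1 / 2)
    {V : Y →L[𝕜] C(ℕ → Bool, 𝕜)}
    (hV : ∀ z, Tendsto (fun n => pathOperator c h.norm_le_one n z) atTop (𝓝 (V z))) (m : ℕ) :
    ‖V (T (x m)) - haarSystem 𝕜 m‖ ≤ q ^ m := by
  refine (ContinuousMap.norm_le _ (pow_nonneg h.pos.le m)).2 fun s => ?_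
  obtain ⟨n₀, hn₀, heq⟩ := h.exists_lt_pathIndex_apply_eq m s
  have hlim : Tendsto (fun n => c (pathIndex s (n + n₀)) (T (x m))) atTop (𝓝 (V (T (x m)) s)) :=
    (((continuous_eval_const s).tendsto _).comp (hV (T (x m)))).comp (tendsto_add_atTop_nat n₀)
  have hstep : ∀ n, dist (c (pathIndex s (n + n₀)) (T (x m)))
      (c (pathIndex s (n + 1 + n₀)) (T (x m))) ≤ q ^ (m + 1) * q ^ n := by
    intro n
    have hle : m + 1 + n ≤ pathIndex s (n + n₀) := by
      have := (pathIndex_strictMono s).add_le_nat n n₀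
      omega
    rw [dist_comm, dist_eq_norm, ← pow_add, add_right_comm]
    exact h.norm_pathIndex_succ_sub_le (by linarith) (by omega) hle (.inr rfl)
  rw [ContinuousMap.sub_apply, ← dist_eq_norm, dist_comm, ← heq]
  have := dist_le_of_le_geometric_of_tendsto₀ q (q ^ (m + 1)) (by linarith) hstep hlim
  rw [zero_add] at this
  refine this.trans ?_
  rw [div_le_iff₀ (by linarith), pow_succ]
  exact mul_le_mul_of_nonneg_left (by linarith) (pow_nonneg h.pos.le m)

end HaarTree

/-! ### Exact interpolation -/

section Biorthogonal

variable {𝕜 : Type*} [RCLike 𝕜]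
  {Y : Type*} [NormedAddCommGroup Y] [NormedSpace 𝕜 Y]
  {Z : Type*} [NormedAddCommGroup Z] [NormedSpace 𝕜 Z]

theorem exists_biorthogonal_of_triangular {d : ℕ → StrongDual 𝕜 Y} {z : ℕ → Y} {K : ℝ}
    (hd : ∀ m, ‖d m‖ ≤ 1) (hdz : ∀ m, d m (z m) = 1) (hdz_lt : ∀ {k m}, m < k → d m (z k) = 0)
    (hK : ∀ k m, ‖d m (z k)‖ ≤ K) :
    ∃ ψ : ℕ → StrongDual 𝕜 Y, (∀ m k, ψ m (z k) = if m = k then 1 else 0) ∧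
      ∀ m, ‖ψ m‖ ≤ (1 + K) ^ m := by
  obtain ⟨ψ, hψ⟩ : ∃ ψ : ℕ → StrongDual 𝕜 Y,
      ∀ m, ψ m = d m - ∑ k ∈ Finset.range m, d m (z k) • ψ k := by
    simp only [Finset.sum_range]
    exact exists_seq_of_forall_exists_extension
      (Q := fun m p φ => φ = d m - ∑ k : Fin m, d m (z k) • p k) fun m p => ⟨_, rfl⟩
  refine ⟨ψ, fun m => ?_, fun m => ?_⟩
  · induction m using Nat.strong_induction_on with | _ m ih
    intro k
    have hsum : ∑ i ∈ Finset.range m, d m (z i) * ψ i (z k) = if k < m then d m (z k) else 0 := by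
      rw [Finset.sum_congr rfl fun i hi => by rw [ih i (Finset.mem_range.1 hi) k]]
      simp
    rw [hψ m]
    simp only [sub_apply, sum_apply, smul_apply, smul_eq_mul, hsum]
    rcases lt_trichotomy k m with hlt | rfl | hlt
    · simp [hlt, hlt.ne']
    · simp [hdz]
    · simp [hdz_lt hlt, hlt.not_gt, hlt.ne]
  · induction m using Nat.strong_induction_on with | _ m ih
    have hK0 : 0 ≤ K := (norm_nonneg _).trans (hK 0 0)
    calc ‖ψ m‖ ≤ ‖d m‖ + ∑ k ∈ Finset.range m, ‖d m (z k)‖ * ‖ψ k‖ := by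
          rw [hψ m]
          exact norm_sub_le_of_le le_rfl
            (norm_sum_le_of_le _ fun k _ => (norm_smul _ _).le)
      _ ≤ 1 + ∑ k ∈ Finset.range m, K * (1 + K) ^ k := by
          gcongr with k hk
          exacts [hd m, hK k m, ih k (Finset.mem_range.1 hk)]
      _ = (1 + K) ^ m := by
          have hgeom := mul_geom_sum (1 + K) m
          rw [add_sub_cancel_left] at hgeom
          rw [← Finset.mul_sum, hgeom, add_sub_cancel]

theorem exists_apply_eq_of_summable_norm_mul_norm_sub [CompleteSpace Z] {ι : Type*}
    [DecidableEq ι] {ψ : ι → StrongDual 𝕜 Y} {z : ι → Y}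
    (hψ : ∀ i k, ψ i (z k) = if i = k then 1 else 0)
    (V : Y →L[𝕜] Z) {w : ι → Z} (hV : Summable fun i => ‖ψ i‖ * ‖w i - V (z i)‖) :
    ∃ V' : Y →L[𝕜] Z, ∀ i, V' (z i) = w i := by
  have hsum : Summable fun i => (ψ i).smulRight (w i - V (z i)) :=
    .of_norm (by simpa only [ContinuousLinearMap.norm_smulRight_apply] using hV)
  refine ⟨V + ∑' i, (ψ i).smulRight (w i - V (z i)), fun k => ?_⟩
  have happly : (∑' i, (ψ i).smulRight (w i - V (z i))) (z k) = w k - V (z k) := by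
    rw [← ContinuousLinearMap.apply_apply (z k), ContinuousLinearMap.map_tsum _ hsum,
      tsum_eq_single k fun i hi => by simp [hψ, hi]]
    simp [hψ]
  rw [add_apply, happly, add_sub_cancel]

end Biorthogonal

section HaarTree

variable {𝕜 : Type*} [RCLike 𝕜]
  {X : Type*} [NormedAddCommGroup X] [NormedSpace 𝕜 X]
  {Y : Type*} [NormedAddCommGroup Y] [NormedSpace 𝕜 Y]

section

variable {T : X →L[𝕜] Y} {y : ℕ → Y} {q : ℝ} {c : ℕ → StrongDual 𝕜 Y} {x : ℕ → X} {C : ℝ}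

theorem IsHaarTree.exists_biorthogonal (h : IsHaarTree T y q c x) (hx : ∀ m, ‖x m‖ ≤ C) :
    ∃ ψ : ℕ → StrongDual 𝕜 Y, (∀ m k, ψ m (T (x k)) = if m = k then 1 else 0) ∧
      ∀ m, ‖ψ m‖ ≤ (1 + ‖T‖ * C) ^ m := by
  refine exists_biorthogonal_of_triangular (d := fun m => c (Nat.bit false m))
    (fun m => h.norm_le_one _) (fun m => by simpa using h.apply_bit m false)
    (fun {k m} hmk => h.apply_of_lt (by rw [Nat.bit_false_apply]; omega)) fun k m => ?_
  simpa using (c _).le_of_opNorm_le_of_le (h.norm_le_one _) (T.le_opNorm_of_le (hx k))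

theorem IsHaarTree.exists_apply_eq_haarSystem (h : IsHaarTree T y q c x) (hy : DenseRange y)
    (hx : ∀ m, ‖x m‖ ≤ C) (hq : q ≤ 1 / 2) (hqC : (1 + ‖T‖ * C) * q ≤ 1 / 2) :
    ∃ V : Y →L[𝕜] C(ℕ → Bool, 𝕜), ∀ m, V (T (x m)) = haarSystem 𝕜 m := by
  obtain ⟨V, hV⟩ := h.exists_tendsto_pathOperator (by linarith) hy
  obtain ⟨ψ, hψ, hψ_norm⟩ := h.exists_biorthogonal hx
  refine exists_apply_eq_of_summable_norm_mul_norm_sub hψ V ?_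
  have hC : 0 ≤ C := (norm_nonneg _).trans (hx 0)
  have hq0 : 0 ≤ q := h.pos.le
  refine summable_geometric_two.of_nonneg_of_le (fun m => by positivity) fun m => ?_
  calc ‖ψ m‖ * ‖haarSystem 𝕜 m - V (T (x m))‖ ≤ (1 + ‖T‖ * C) ^ m * q ^ m := by
        rw [norm_sub_rev]
        gcongr
        exacts [hψ_norm m, h.norm_sub_haarSystem_le_of_tendsto hq hV m]
    _ ≤ (1 / 2) ^ m := by
        rw [← mul_pow]
        gcongr

end

theorem exists_bounded_seq_apply_eq_haarSystem [SeparableSpace Y] (T : X →L[𝕜] Y)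
    (hT : ¬ IsSeparable (Set.range (banachAdjoint T))) :
    ∃ (x : ℕ → X) (C : ℝ) (V : Y →L[𝕜] C(ℕ → Bool, 𝕜)),
      (∀ m, ‖x m‖ ≤ C) ∧ ∀ m, V (T (x m)) = haarSystem 𝕜 m := by
  obtain ⟨C, hC⟩ := exists_isHaarTree T hT
  obtain ⟨r, hr, hrC⟩ := exists_pos_mul_lt one_half_pos (1 + ‖T‖ * C)
  have hq : 0 < min r (1 / 2) := lt_min hr one_half_pos
  obtain ⟨c, x, h, hx⟩ := hC (denseSeq Y) hq
  have hC0 : 0 ≤ C := (norm_nonneg _).trans (hx 0)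
  obtain ⟨V, hV⟩ := h.exists_apply_eq_haarSystem (denseRange_denseSeq Y) hx (min_le_right _ _)
    ((mul_le_mul_of_nonneg_left (min_le_left _ _) (by positivity)).trans hrC.le)
  exact ⟨x, C, V, hx, hV⟩

end HaarTree

/-! ### The Haar operator -/

section HaarOperator

variable {𝕜 : Type*} [RCLike 𝕜]

section EllOne

variable {Z : Type*} [NormedAddCommGroup Z] [NormedSpace 𝕜 Z]

theorem ellOne_hom_ext {S S' : lp (fun _ : ℕ => 𝕜) 1 →L[𝕜] Z}
    (h : ∀ m, S (lp.single 1 m (1 : 𝕜)) = S' (lp.single 1 m (1 : 𝕜))) : S = S' :=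
  lp.ext_continuousLinearMap ENNReal.one_ne_top fun m => ContinuousLinearMap.ext_ring (h m)

theorem exists_ellOne_hom [CompleteSpace Z] {z : ℕ → Z} {C : ℝ} (hz : ∀ m, ‖z m‖ ≤ C) :
    ∃ S : lp (fun _ : ℕ => 𝕜) 1 →L[𝕜] Z, ∀ m, S (lp.single 1 m (1 : 𝕜)) = z m := by
  have hC : 0 ≤ C := (norm_nonneg _).trans (hz 0)
  have hnorm : ∀ m, ‖ContinuousLinearMap.toSpanSingleton 𝕜 (z m)‖ ≤ C := fun m =>
    (ContinuousLinearMap.norm_toSpanSingleton (z m)).trans_le (hz m)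
  refine ⟨lp.tsumCLM 𝕜 ℕ Z ∘L lp.mapCLM 1 (fun m => .toSpanSingleton 𝕜 (z m)) hC hnorm,
    fun m => ?_⟩
  change ∑' k, (lp.single 1 m (1 : 𝕜) : lp (fun _ : ℕ => 𝕜) 1) k • z k = z m
  rw [tsum_eq_single m fun k hk => by rw [lp.single_apply_ne _ _ _ hk, zero_smul],
    lp.single_apply_self, one_smul]

end EllOne

theorem existsUnique_mapsUnitVectorsToHaar :
    ∃! J : lp (fun _ : ℕ => 𝕜) 1 →L[𝕜] C(ℕ → Bool, 𝕜), MapsUnitVectorsToHaar J := by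
  obtain ⟨J, hJ⟩ := exists_ellOne_hom (𝕜 := 𝕜) (norm_haarSystem_le 𝕜)
  exact ⟨J, hJ, fun J' hJ' => ellOne_hom_ext fun m => (hJ' m).trans (hJ m).symm⟩

variable {J : lp (fun _ : ℕ => 𝕜) 1 →L[𝕜] C(ℕ → Bool, 𝕜)}

theorem MapsUnitVectorsToHaar.operatorFactorsThrough (hJ : MapsUnitVectorsToHaar J)
    {X : Type*} [NormedAddCommGroup X] [NormedSpace 𝕜 X] [CompleteSpace X]
    {Y : Type*} [NormedAddCommGroup Y] [NormedSpace 𝕜 Y] [SeparableSpace Y]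
    (T : X →L[𝕜] Y) (hT : ¬ IsSeparable (Set.range (banachAdjoint T))) :
    OperatorFactorsThrough J T := by
  obtain ⟨x, C, V, hx, hV⟩ := exists_bounded_seq_apply_eq_haarSystem T hT
  obtain ⟨U, hU⟩ := exists_ellOne_hom (𝕜 := 𝕜) hx
  exact ⟨U, V, ellOne_hom_ext fun m => by
    rw [ContinuousLinearMap.comp_apply, ContinuousLinearMap.comp_apply, hU, hV, hJ m]⟩

theorem MapsUnitVectorsToHaar.one_le_dist_banachAdjoint_evalCLM (hJ : MapsUnitVectorsToHaar J)
    {s s' : ℕ → Bool} (h : s ≠ s') :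
    1 ≤ dist (banachAdjoint J (ContinuousMap.evalCLM 𝕜 s))
      (banachAdjoint J (ContinuousMap.evalCLM 𝕜 s')) := by
  obtain ⟨m, hm⟩ := exists_one_le_norm_haarSystem_apply_sub 𝕜 h
  have hle := (banachAdjoint J (ContinuousMap.evalCLM 𝕜 s) -
    banachAdjoint J (ContinuousMap.evalCLM 𝕜 s')).le_opNorm (lp.single 1 m (1 : 𝕜))
  rw [lp.norm_single one_pos, norm_one, mul_one, ← dist_eq_norm] at hle
  refine le_trans ?_ hle
  change 1 ≤ ‖J (lp.single 1 m (1 : 𝕜)) s - J (lp.single 1 m (1 : 𝕜)) s'‖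
  rwa [hJ m]

theorem MapsUnitVectorsToHaar.not_isSeparable_range_banachAdjoint
    (hJ : MapsUnitVectorsToHaar J) : ¬ IsSeparable (Set.range (banachAdjoint J)) := by
  intro hsep
  have : Countable (ℕ → Bool) :=
    countable_of_isSeparable_range (f := fun s => banachAdjoint J (ContinuousMap.evalCLM 𝕜 s))
      (hsep.mono (Set.range_comp_subset_range _ _)) one_pos
      fun _ _ => hJ.one_le_dist_banachAdjoint_evalCLM
  have hle := Cardinal.mk_le_aleph0 (α := ℕ → Bool)
  rw [← Cardinal.power_def, Cardinal.mk_bool, Cardinal.mk_nat] at hle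
  exact (Cardinal.cantor _).not_ge hle

end HaarOperator

theorem mainTheorem5_general {𝕜 : Type w} [RCLike 𝕜] :
    (∃! J : lp (fun _ : ℕ => 𝕜) 1 →L[𝕜] C(ℕ → Bool, 𝕜), MapsUnitVectorsToHaar J) ∧
    ∀ J : lp (fun _ : ℕ => 𝕜) 1 →L[𝕜] C(ℕ → Bool, 𝕜), MapsUnitVectorsToHaar J →
      SepCodomainNonsepAdjoint J ∧
      ∀ (X : Type u) [NormedAddCommGroup X] [NormedSpace 𝕜 X] [CompleteSpace X]
        (Y : Type v) [NormedAddCommGroup Y] [NormedSpace 𝕜 Y] (T : X →L[𝕜] Y),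
        SepCodomainNonsepAdjoint T → OperatorFactorsThrough J T :=
  ⟨existsUnique_mapsUnitVectorsToHaar, fun _ hJ =>
    ⟨⟨inferInstance, hJ.not_isSeparable_range_banachAdjoint⟩, fun _ _ _ _ _ _ _ T ⟨_, hT⟩ =>
      hJ.operatorFactorsThrough T hT⟩⟩

theorem mainTheorem5 {𝕜 : Type w} [RCLike 𝕜] :
    (∃! J : lp (fun _ : ℕ => 𝕜) 1 →L[𝕜] C(ℕ → Bool, 𝕜), MapsUnitVectorsToHaar J) ∧
    ∀ J : lp (fun _ : ℕ => 𝕜) 1 →L[𝕜] C(ℕ → Bool, 𝕜), MapsUnitVectorsToHaar J →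
      (∀ (X : Type u) [NormedAddCommGroup X] [NormedSpace 𝕜 X] [CompleteSpace X]
        (Y : Type v) [NormedAddCommGroup Y] [NormedSpace 𝕜 Y] [CompleteSpace Y]
        [TopologicalSpace.SeparableSpace Y] (T : X →L[𝕜] Y),
        ¬ TopologicalSpace.IsSeparable (Set.range (banachAdjoint T)) →
          OperatorFactorsThrough J T) ∧
      IsUniversalSepCodomainNonsepAdjoint.{u, v} J :=
  mainTheorem5_general.imp_right fun h J hJ =>
    ⟨fun X _ _ _ Y _ _ _ hY T hT => (h J hJ).2 X Y T ⟨hY, hT⟩,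
      (h J hJ).1, fun X _ _ _ Y _ _ _ T hT => (h J hJ).2 X Y T hT⟩
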